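/- A (real) Banach lattice $P$ is called $1^+$-projective if for every $\varepsilon>0$, every Banach lattice $X$, every closed (lattice) ideal $J$ of $X$ with quotient map $Q\colon X\to X/J$, and every Banach lattice homomorphism $T\colon P\to X/J$, there is a Banach lattice homomorphism $\hat T\colon P\to X$ with $Q\circ\hat T=T$ and $\|\hat T\|\le(1+\varepsilon)\|T\|$. A compact Hausdorff space $K$ is called an absolute neighbourhood retract if, whenever $i\colon K\to X$ is a homeomorphism of $K$ onto a subspace of a compact Hausdorff space $X$, there are an open set $U$ with $i(K)\subseteq U\subseteq X$ and a continuous map $\varphi\colon U\to K$ such that $\varphi(i(k))=k$ for all $k\in K$. Theorem. Let $K$ be a compact Hausdorff space, and let $C(K)$ be the Banach lattice of real-valued continuous functions on $K$ with the supremum norm and the pointwise order. Then $C(K)$ is $1^+$-projective if and only if $K$ is an absolute neighbourhood retract. -/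

import Mathlib

universe u

/-- A (real) Banach lattice: a complete normed real vector lattice whose norm is a lattice norm,
i.e. `|x| ≤ |y|` implies `‖x‖ ≤ ‖y‖`. -/
class BanachLattice (X : Type*) [NormedAddCommGroup X] [NormedSpace ℝ X] [Lattice X] : Prop
    extends IsOrderedAddMonoid X, IsOrderedModule ℝ X, HasSolidNorm X, CompleteSpace X

/-- `C(K)`, with the supremum norm and the pointwise order, is a Banach lattice. -/
instance ContinuousMap.instBanachLattice {K : Type*} [TopologicalSpace K] [CompactSpace K] :
    BanachLattice C(K, ℝ) where
  add_le_add_left _ _ h c := fun t => add_le_add_left (h t) (c t)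
  smul_le_smul_of_nonneg_left _ hr _ _ h := fun t => mul_le_mul_of_nonneg_left (h t) hr
  smul_le_smul_of_nonneg_right f hf _ _ h := fun t => mul_le_mul_of_nonneg_right h (hf t)
  solid f g h := by
    refine (ContinuousMap.norm_le f (norm_nonneg g)).2 fun t => ?_
    have ht : |f t| ≤ |g t| := by simpa using h t
    exact le_trans ht (g.norm_coe_le_norm t)

/-- A bounded linear operator between Banach lattices is a Banach lattice homomorphism if it
preserves the lattice operations. -/
structure IsLatticeHom {X Y : Type*}
    [NormedAddCommGroup X] [NormedSpace ℝ X] [Lattice X] [BanachLattice X]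
    [NormedAddCommGroup Y] [NormedSpace ℝ Y] [Lattice Y] [BanachLattice Y]
    (T : X →L[ℝ] Y) : Prop where
  map_sup : ∀ x y : X, T (x ⊔ y) = T x ⊔ T y
  map_inf : ∀ x y : X, T (x ⊓ y) = T x ⊓ T y

/-- A (lattice) ideal of a Banach lattice is a solid linear subspace: `x ∈ J` and `|y| ≤ |x|`
imply `y ∈ J`. -/
class IsLatticeIdeal {X : Type*} [NormedAddCommGroup X] [NormedSpace ℝ X] [Lattice X]
    (J : Submodule ℝ X) : Prop where
  solid : LatticeOrderedAddCommGroup.IsSolid (J : Set X)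

namespace IsLatticeIdeal

variable {X : Type*} [NormedAddCommGroup X] [NormedSpace ℝ X] [Lattice X] [BanachLattice X]
  (J : Submodule ℝ X) [IsLatticeIdeal J]

theorem sup_sub_sup_mem {a a' b b' : X} (ha : a - a' ∈ J) (hb : b - b' ∈ J) :
    a ⊔ b - a' ⊔ b' ∈ J := by
  have h1 : a ⊔ b - a' ⊔ b ∈ J := solid (J := J) ha (abs_sup_sub_sup_le_abs a a' b)
  have h2 : a' ⊔ b - a' ⊔ b' ∈ J := by
    rw [sup_comm a' b, sup_comm a' b']
    exact solid (J := J) hb (abs_sup_sub_sup_le_abs b b' a')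
  simpa using J.add_mem h1 h2

theorem inf_sub_inf_mem {a a' b b' : X} (ha : a - a' ∈ J) (hb : b - b' ∈ J) :
    a ⊓ b - a' ⊓ b' ∈ J := by
  have h1 : a ⊓ b - a' ⊓ b ∈ J := solid (J := J) ha (abs_inf_sub_inf_le_abs a a' b)
  have h2 : a' ⊓ b - a' ⊓ b' ∈ J := by
    rw [inf_comm a' b, inf_comm a' b']
    exact solid (J := J) hb (abs_inf_sub_inf_le_abs b b' a')
  simpa using J.add_mem h1 h2

/-- `[x] ⊔ [y] = [x ⊔ y]` in `X ⧸ J`. -/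
instance instMax : Max (X ⧸ J) where
  max := Quotient.map₂ (· ⊔ ·) fun _ _ ha _ _ hb =>
    (Submodule.quotientRel_def J).2
      (sup_sub_sup_mem J ((Submodule.quotientRel_def J).1 ha) ((Submodule.quotientRel_def J).1 hb))

/-- `[x] ⊓ [y] = [x ⊓ y]` in `X ⧸ J`. -/
instance instMin : Min (X ⧸ J) where
  min := Quotient.map₂ (· ⊓ ·) fun _ _ ha _ _ hb =>
    (Submodule.quotientRel_def J).2
      (inf_sub_inf_mem J ((Submodule.quotientRel_def J).1 ha) ((Submodule.quotientRel_def J).1 hb))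

/-- The quotient vector lattice `X ⧸ J`; the order is `[x] ≤ [y] ↔ [x ⊔ y] = [y]`. -/
instance instLattice : Lattice (X ⧸ J) :=
  Lattice.mk'
    (by rintro ⟨a⟩ ⟨b⟩; exact congrArg (Submodule.Quotient.mk (p := J)) (sup_comm a b))
    (by rintro ⟨a⟩ ⟨b⟩ ⟨c⟩; exact congrArg (Submodule.Quotient.mk (p := J)) (sup_assoc a b c))
    (by rintro ⟨a⟩ ⟨b⟩; exact congrArg (Submodule.Quotient.mk (p := J)) (inf_comm a b))
    (by rintro ⟨a⟩ ⟨b⟩ ⟨c⟩; exact congrArg (Submodule.Quotient.mk (p := J)) (inf_assoc a b c))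
    (by rintro ⟨a⟩ ⟨b⟩; exact congrArg (Submodule.Quotient.mk (p := J)) (sup_inf_self (a := a) (b := b)))
    (by rintro ⟨a⟩ ⟨b⟩; exact congrArg (Submodule.Quotient.mk (p := J)) (inf_sup_self (a := a) (b := b)))

theorem mk_sup (a b : X) :
    (Submodule.Quotient.mk (a ⊔ b) : X ⧸ J) = Submodule.Quotient.mk a ⊔ Submodule.Quotient.mk b :=
  rfl

theorem mk_inf (a b : X) :
    (Submodule.Quotient.mk (a ⊓ b) : X ⧸ J) = Submodule.Quotient.mk a ⊓ Submodule.Quotient.mk b :=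
  rfl

theorem mk_mono {a b : X} (h : a ≤ b) :
    (Submodule.Quotient.mk a : X ⧸ J) ≤ Submodule.Quotient.mk b := by
  rw [← sup_eq_right, ← mk_sup, sup_eq_right.2 h]

/-- If `[a] ≤ [b]`, then `b` can be replaced by an equivalent `c ≥ a`. -/
theorem exists_ge_of_mk_le {a : X} {b : X ⧸ J} (h : Submodule.Quotient.mk a ≤ b) :
    ∃ c : X, a ≤ c ∧ Submodule.Quotient.mk c = b := by
  obtain ⟨b, rfl⟩ := Submodule.Quotient.mk_surjective J b
  exact ⟨a ⊔ b, le_sup_left, by rw [mk_sup, sup_eq_right.2 h]⟩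

theorem mk_abs (a : X) : (Submodule.Quotient.mk |a| : X ⧸ J) = |Submodule.Quotient.mk a| := rfl

/-- The quotient of a Banach lattice by a closed ideal, with the quotient norm, is a Banach
lattice. -/
instance instBanachLattice [IsClosed (J : Set X)] : BanachLattice (X ⧸ J) where
  add_le_add_left a b h c := by
    obtain ⟨a, rfl⟩ := Submodule.Quotient.mk_surjective J a
    obtain ⟨c, rfl⟩ := Submodule.Quotient.mk_surjective J c
    obtain ⟨b, hab, rfl⟩ := exists_ge_of_mk_le J h
    exact mk_mono J (add_le_add_left hab c)
  smul_le_smul_of_nonneg_left r hr a b h := by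
    obtain ⟨a, rfl⟩ := Submodule.Quotient.mk_surjective J a
    obtain ⟨b, hab, rfl⟩ := exists_ge_of_mk_le J h
    exact mk_mono J (smul_le_smul_of_nonneg_left hab hr)
  smul_le_smul_of_nonneg_right a ha r s h := by
    obtain ⟨a, ha', rfl⟩ := exists_ge_of_mk_le J (a := 0) ha
    exact mk_mono J (smul_le_smul_of_nonneg_right h ha')
  solid := by
    intro x y h
    obtain ⟨x, rfl⟩ := Submodule.Quotient.mk_surjective J x
    refine le_of_forall_pos_le_add fun ε hε => ?_
    obtain ⟨y, rfl, hy⟩ := Submodule.Quotient.norm_mk_lt (S := J) y hε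
    have hx : (Submodule.Quotient.mk ((x ⊓ |y|) ⊔ -|y|) : X ⧸ J) = Submodule.Quotient.mk x := by
      have h1 : (Submodule.Quotient.mk x : X ⧸ J) ≤ Submodule.Quotient.mk |y| :=
        le_trans le_sup_left h
      have h2 : (Submodule.Quotient.mk (-|y|) : X ⧸ J) ≤ Submodule.Quotient.mk x := by
        obtain ⟨c, hc, hcy⟩ := exists_ge_of_mk_le J (a := -x) (b := Submodule.Quotient.mk |y|)
          (le_trans le_sup_right h)
        rw [Submodule.Quotient.mk_neg, ← hcy, ← Submodule.Quotient.mk_neg]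
        exact mk_mono J (neg_le.1 hc)
      rw [mk_sup, mk_inf, inf_eq_left.2 h1, sup_eq_left.2 h2]
    have hle : |((x ⊓ |y|) ⊔ (-|y|))| ≤ |y| :=
      abs_le'.2 ⟨sup_le inf_le_right (neg_le_self (abs_nonneg y)), neg_le.1 le_sup_right⟩
    rw [← hx]
    exact (Submodule.Quotient.norm_mk_le J _).trans ((HasSolidNorm.solid hle).trans hy.le)

end IsLatticeIdeal

/-- `P` is `lam`-projective: for every Banach lattice `X` and closed ideal `J` of `X`, every
Banach lattice homomorphism `T : P → X ⧸ J` lifts through the quotient map `X → X ⧸ J` to a Banach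
lattice homomorphism `S : P → X` with `‖S‖ ≤ lam * ‖T‖`. -/
def IsLambdaProjective (lam : ℝ) (P : Type u) [NormedAddCommGroup P] [NormedSpace ℝ P] [Lattice P]
    [BanachLattice P] : Prop :=
  ∀ (X : Type u) [NormedAddCommGroup X] [NormedSpace ℝ X] [Lattice X] [BanachLattice X]
    (J : Submodule ℝ X) [IsLatticeIdeal J] [IsClosed (J : Set X)]
    (T : P →L[ℝ] X ⧸ J), IsLatticeHom T →
    ∃ S : P →L[ℝ] X, IsLatticeHom S ∧ (∀ p : P, Submodule.Quotient.mk (S p) = T p) ∧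
      ‖S‖ ≤ lam * ‖T‖

/-- `P` is `1⁺`-projective: it is `(1 + ε)`-projective for every `ε > 0`. -/
def IsOnePlusProjective (P : Type u) [NormedAddCommGroup P] [NormedSpace ℝ P] [Lattice P]
    [BanachLattice P] : Prop :=
  ∀ ε : ℝ, 0 < ε → IsLambdaProjective (1 + ε) P

/-- `K` is an absolute neighbourhood retract (in the class of compact Hausdorff spaces): whenever
`i` is a homeomorphism of `K` onto a subspace of a compact Hausdorff space `X`, there are an open
set `U ⊇ i(K)` of `X` and a continuous `φ : U → K` with `φ (i k) = k` for all `k`. -/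
def IsANR (K : Type u) [TopologicalSpace K] : Prop :=
  ∀ (X : Type u) [TopologicalSpace X] [CompactSpace X] [T2Space X] (i : K → X), Topology.IsEmbedding i →
    ∃ (U : Set X) (φ : U → K), IsOpen U ∧ Continuous φ ∧
      ∃ h : ∀ k : K, i k ∈ U, ∀ k : K, φ ⟨i k, h k⟩ = k

/-! Suppose `C(K)` is `lam`-projective for some `lam`, and let `K` be embedded in `X`. By Tietze,
restriction `C(X) → C(K)` is a quotient map by a closed ideal, so the resulting homomorphism from
`C(K)` to the quotient lifts to a lattice homomorphism `S : C(K) → C(X)` that extends functions.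
Wherever `S 1 > 0`, the map `f ↦ S f x / S 1 x` is a unital real lattice homomorphism, hence
evaluation at a point `φ x` of `K`. This `φ` is the retraction; the norm of `S` plays no role.

Conversely, embed `K` in the cube indexed by `C(K, [0,1])`. A neighbourhood retraction, multiplied
by a cut-off, gives a lattice homomorphism `E` from `C(K)` to the functions on the cube, right
inverse to restriction. So it suffices to lift `T` composed with restriction. Lift `T 1` to some `x
≥ 0` of nearly the same norm, lift the images of the coordinates into `[0, x]`, and extend to the
cube by `exists_cube_calculus`. The required identity holds on `1` and the coordinates, hence
everywhere by Stone–Weierstrass.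

The calculus is a Kakutani representation of the ideal generated by `x`, which needs enough
characters. The model of an `IsMinFunctional` is `v ↦ min v` over a closed set of characters: larger
functionals correspond to smaller sets, and a maximal one, found by Zorn, to a point. -/

/-! ### Existence of characters on a vector lattice with order unit -/

section OrderUnit

/-- A functional on a vector lattice with order unit `e` which is superadditive, preserves infima
and takes values at least `t` above `t • e`. -/
structure IsMinFunctional {E : Type*} [AddCommGroup E] [Module ℝ E] [Lattice E] (e : E)
    (q : E → ℝ) : Prop where
  superadd : ∀ u v, q u + q v ≤ q (u + v)
  map_inf : ∀ u v, q (u ⊓ v) = min (q u) (q v)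
  nsmul_le : ∀ (n : ℕ) (v : E), 0 < n → q (n • v) ≤ n * q v
  le_of_smul_le : ∀ (t : ℝ) (v : E), t • e ≤ v → t ≤ q v

/-- The unital real-valued vector lattice homomorphisms on a vector lattice with unit `e`. -/
def latticeCharacters {E : Type*} [AddCommGroup E] [Module ℝ E] [Lattice E] (e : E) :
    Set (E → ℝ) :=
  {φ | (∀ u v, φ (u + v) = φ u + φ v) ∧ (∀ (c : ℝ) v, φ (c • v) = c * φ v) ∧
    (∀ u v, φ (u ⊓ v) = min (φ u) (φ v)) ∧ φ e = 1}

variable {E : Type*} [AddCommGroup E] [Module ℝ E] [Lattice E] {e : E}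

namespace IsMinFunctional

variable {q : E → ℝ}

theorem mono (hq : IsMinFunctional e q) {u v : E} (h : u ≤ v) : q u ≤ q v := by
  have := hq.map_inf u v
  rw [inf_eq_left.2 h] at this
  rw [this]; exact min_le_right _ _

theorem map_zero (hq : IsMinFunctional e q) : q 0 = 0 := by
  have h1 := hq.superadd 0 0
  have h2 := hq.le_of_smul_le 0 0 (by simp)
  rw [add_zero] at h1
  linarith

theorem nsmul_eq_zero (hq : IsMinFunctional e q) {b : E} (hb : q b = 0) (n : ℕ) :
    q (n • b) = 0 := by
  refine le_antisymm ?_ ?_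
  · rcases n.eq_zero_or_pos with rfl | hn
    · simp [hq.map_zero]
    · simpa [hb] using hq.nsmul_le n b hn
  · induction n with
    | zero => simp [hq.map_zero]
    | succ n ih =>
      rw [succ_nsmul]
      linarith [hq.superadd (n • b) b]

/-- The supremum of a suitably directed family of functionals. -/
theorem iSup_of_directed (hu : ∀ v : E, ∃ t : ℝ, v ≤ t • e) {ι : Type*} [Nonempty ι]
    {f : ι → E → ℝ}
    (hadd : ∀ i j u v, ∃ k, f i u + f j v ≤ f k (u + v))
    (hdir : ∀ i j, ∃ k, f i ≤ f k ∧ f j ≤ f k)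
    (hinf : ∀ i u v, f i (u ⊓ v) = min (f i u) (f i v))
    (hsmul : ∀ i (n : ℕ) v, 0 < n → ∃ k, f i (n • v) ≤ n * f k v)
    (hle : ∀ (t : ℝ) (v : E), t • e ≤ v → ∃ i, t ≤ f i v)
    (hub : ∀ i (s : ℝ) (v : E), v ≤ s • e → f i v ≤ s) :
    (∀ i, f i ≤ fun v => ⨆ j, f j v) ∧ IsMinFunctional e fun v => ⨆ j, f j v := by
  have hbdd : ∀ v, BddAbove (Set.range fun j => f j v) := fun v => by
    obtain ⟨t, ht⟩ := hu v
    exact ⟨t, by rintro _ ⟨j, rfl⟩; exact hub j t v ht⟩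
  have hle' : ∀ i v, f i v ≤ ⨆ j, f j v := fun i v => le_ciSup (hbdd v) i
  refine ⟨fun i v => hle' i v, ⟨fun u v => ?_, fun u v => le_antisymm ?_ ?_, fun n v hn => ?_,
    fun t v htv => ?_⟩⟩
  · refine le_of_forall_lt fun c hc => ?_
    have hc' : c - (⨆ j, f j v) < ⨆ j, f j u := by linarith
    obtain ⟨i, hi⟩ := exists_lt_of_lt_ciSup hc'
    obtain ⟨j, hj⟩ := exists_lt_of_lt_ciSup (show c - f i u < ⨆ j, f j v by linarith)
    obtain ⟨k, hk⟩ := hadd i j u v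
    linarith [hle' k (u + v)]
  · refine ciSup_le fun i => ?_
    rw [hinf]
    exact min_le_min (hle' i u) (hle' i v)
  · refine le_of_forall_lt fun c hc => ?_
    obtain ⟨i, hi⟩ := exists_lt_of_lt_ciSup (lt_min_iff.1 hc).1
    obtain ⟨j, hj⟩ := exists_lt_of_lt_ciSup (lt_min_iff.1 hc).2
    obtain ⟨k, hik, hjk⟩ := hdir i j
    refine lt_of_lt_of_le ?_ (hle' k (u ⊓ v))
    rw [hinf]
    exact lt_min (hi.trans_le (hik u)) (hj.trans_le (hjk v))
  · refine ciSup_le fun i => ?_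
    obtain ⟨k, hk⟩ := hsmul i n v hn
    exact hk.trans (mul_le_mul_of_nonneg_left (hle' k v) n.cast_nonneg)
  · obtain ⟨i, hi⟩ := hle t v htv
    exact hi.trans (hle' i v)

variable [IsOrderedAddMonoid E]

theorem le_of_le_smul (hq : IsMinFunctional e q) {t : ℝ} {v : E} (h : v ≤ t • e) : q v ≤ t := by
  have h1 := hq.superadd v (-v)
  have h2 := hq.le_of_smul_le (-t) (-v) (by rw [neg_smul]; exact neg_le_neg h)
  rw [add_neg_cancel, hq.map_zero] at h1
  linarith

theorem map_smul_unit (hq : IsMinFunctional e q) (t : ℝ) : q (t • e) = t :=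
  le_antisymm (hq.le_of_le_smul le_rfl) (hq.le_of_smul_le t _ le_rfl)

/-- Since `q` is exact on multiples of `e`, superadditivity can be used in both directions. This
normalises any `v` to have minimum `0`, as localisation requires. -/
theorem map_add_neg_smul (hq : IsMinFunctional e q) (v : E) : q (v + (-q v) • e) = 0 := by
  have h1 := hq.superadd v ((-q v) • e)
  have h2 := hq.superadd (v + (-q v) • e) (q v • e)
  rw [neg_smul, neg_add_cancel_right, hq.map_smul_unit] at h2
  rw [hq.map_smul_unit] at h1
  rw [neg_smul] at h1 ⊢
  linarith

/-- Localising a functional at the elements where `b` is minimal. -/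
theorem exists_ge_map_add_le (hu : ∀ v : E, ∃ t : ℝ, v ≤ t • e) (hq : IsMinFunctional e q)
    {b : E} (hb : q b = 0) :
    ∃ q', IsMinFunctional e q' ∧ q ≤ q' ∧ ∀ v, q (v + b) ≤ q' v := by
  have hmono : ∀ {m n : ℕ}, m ≤ n → ∀ v, q (v + m • b) ≤ q (v + n • b) := fun {m n} h v => by
    obtain ⟨k, rfl⟩ := Nat.exists_eq_add_of_le h
    have h1 := hq.superadd (v + m • b) (k • b)
    have h2 := hq.nsmul_eq_zero hb k
    rw [add_nsmul, ← add_assoc]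
    linarith
  -- In the model, a growing multiple of `b` penalises every point where `b > 0`, so the supremum is
  -- the minimum of `v` over the zero set of `b`.
  obtain ⟨h1, h2⟩ := iSup_of_directed (f := fun (n : ℕ) v => q (v + n • b)) hu
    (fun i j u v => ⟨i + j, by
      have := hq.superadd (u + i • b) (v + j • b)
      rwa [add_add_add_comm, ← add_nsmul] at this⟩)
    (fun i j => ⟨max i j, hmono (le_max_left i j), hmono (le_max_right i j)⟩)
    (fun i u v => by rw [inf_add, hq.map_inf])
    (fun i n v hn => ⟨i, by
      refine (hmono (Nat.le_mul_of_pos_left i hn) (n • v)).trans ?_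
      rw [mul_nsmul', ← nsmul_add]
      exact hq.nsmul_le n _ hn⟩)
    (fun t v h => ⟨0, by simpa using hq.le_of_smul_le t v h⟩)
    (fun i s v h => by
      have h3 := hq.superadd (v + i • b) (-v)
      rw [add_neg_cancel_comm, hq.nsmul_eq_zero hb] at h3
      have h4 := hq.le_of_smul_le (-s) (-v) (by rw [neg_smul]; exact neg_le_neg h)
      linarith)
  exact ⟨_, h2, fun v => by simpa using h1 0 v, fun v => by simpa using h1 1 v⟩

/-- A maximal functional is additive. -/
theorem add_of_maximal (hu : ∀ v : E, ∃ t : ℝ, v ≤ t • e)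
    (hq : Maximal (IsMinFunctional e) q) (u v : E) : q (u + v) = q u + q v := by
  have hb := hq.1.map_add_neg_smul v
  obtain ⟨q', hq', hle, hq'b⟩ := exists_ge_map_add_le hu hq.1 hb
  -- Maximality means that localising at the minimum of `v` gains nothing.
  have h1 : q (u + (v + (-q v) • e)) ≤ q u := (hq'b u).trans (hq.2 hq' hle u)
  have h2 := hq.1.superadd (u + v) ((-q v) • e)
  rw [hq.1.map_smul_unit, add_assoc] at h2
  linarith [hq.1.superadd u v]

/-- Zorn applies because the pointwise supremum of a chain is finite, by the bound `q v ≤ t` for `v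
≤ t • e`, and is again a functional of this kind. -/
theorem exists_maximal_ge (hu : ∀ v : E, ∃ t : ℝ, v ≤ t • e) (hq : IsMinFunctional e q) :
    ∃ q', q ≤ q' ∧ Maximal (IsMinFunctional e) q' := by
  refine zorn_le_nonempty₀ {q | IsMinFunctional e q} (fun c hc hchain y hy => ?_) q hq
  have : Nonempty c := ⟨⟨y, hy⟩⟩
  have hdir : ∀ i j : c, ∃ k : c, i.1 ≤ k.1 ∧ j.1 ≤ k.1 := fun i j => by
    rcases hchain.total i.2 j.2 with h | h
    · exact ⟨j, h, le_rfl⟩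
    · exact ⟨i, le_rfl, h⟩
  obtain ⟨h1, h2⟩ := iSup_of_directed (f := fun i : c => i.1) hu
    (fun i j u v => by
      obtain ⟨k, hik, hjk⟩ := hdir i j
      exact ⟨k, (add_le_add (hik u) (hjk v)).trans ((hc k.2).superadd u v)⟩)
    hdir (fun i => (hc i.2).map_inf) (fun i n v hn => ⟨i, (hc i.2).nsmul_le n v hn⟩)
    (fun t v h => ⟨⟨y, hy⟩, (hc hy).le_of_smul_le t v h⟩)
    (fun i s v h => (hc i.2).le_of_le_smul h)
  exact ⟨_, h2, fun z hz => h1 ⟨z, hz⟩⟩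

variable [IsOrderedModule ℝ E]

theorem le_of_smul_unit_le_smul_unit (he : 0 < e) {s t : ℝ} (h : t • e ≤ s • e) : t ≤ s := by
  by_contra! hst
  have h1 : (t - s) • e ≤ 0 := by rw [sub_smul]; exact sub_nonpos.2 h
  have h2 : 0 ≤ (t - s) • e := smul_nonneg (sub_pos.2 hst).le he.le
  rcases smul_eq_zero.1 (le_antisymm h1 h2) with h3 | h3
  · exact (sub_pos.2 hst).ne' h3
  · exact he.ne' h3

/-- `v ↦ sup {t | t • e ≤ v}` is the least functional of this kind. -/
theorem sSup_smul_le (he : 0 < e) (hu : ∀ v : E, ∃ t : ℝ, v ≤ t • e) :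
    IsMinFunctional e fun v => sSup {t : ℝ | t • e ≤ v} := by
  have hbdd : ∀ v : E, BddAbove {t : ℝ | t • e ≤ v} := fun v => by
    obtain ⟨s, hs⟩ := hu v
    exact ⟨s, fun t ht => le_of_smul_unit_le_smul_unit he (le_trans ht hs)⟩
  have hne : ∀ v : E, {t : ℝ | t • e ≤ v}.Nonempty := fun v => by
    obtain ⟨s, hs⟩ := hu (-v)
    exact ⟨-s, by simpa [neg_smul] using neg_le_neg hs⟩
  have key : ∀ (t : ℝ) (v : E), t • e ≤ v → t ≤ sSup {t : ℝ | t • e ≤ v} := fun t v h =>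
    le_csSup (hbdd v) h
  refine ⟨fun u v => ?_, fun u v => le_antisymm (le_min ?_ ?_) ?_,
    fun n v hn => csSup_le (hne _) fun t ht => ?_, key⟩
  · refine le_of_forall_lt fun c hc => ?_
    obtain ⟨s, hs, hcs⟩ := exists_lt_of_lt_csSup (hne u)
      (show c - sSup {t : ℝ | t • e ≤ v} < sSup {t : ℝ | t • e ≤ u} by linarith)
    obtain ⟨t, ht, hct⟩ := exists_lt_of_lt_csSup (hne v)
      (show c - s < sSup {t : ℝ | t • e ≤ v} by linarith)
    have := key (s + t) (u + v) (by rw [add_smul]; exact add_le_add hs ht)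
    linarith
  · exact csSup_le_csSup (hbdd u) (hne _) fun t ht => le_trans ht inf_le_left
  · exact csSup_le_csSup (hbdd v) (hne _) fun t ht => le_trans ht inf_le_right
  · refine le_of_forall_lt_imp_le_of_dense fun c hc => ?_
    obtain ⟨s, hs, hcs⟩ := exists_lt_of_lt_csSup (hne u) (lt_min_iff.1 hc).1
    obtain ⟨t, ht, hct⟩ := exists_lt_of_lt_csSup (hne v) (lt_min_iff.1 hc).2
    exact key c _ (le_inf ((smul_le_smul_of_nonneg_right hcs.le he.le).trans hs)
      ((smul_le_smul_of_nonneg_right hct.le he.le).trans ht))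
  · have hn' : (0 : ℝ) < n := Nat.cast_pos.2 hn
    have h1 : (n : ℝ)⁻¹ • t • e ≤ (n : ℝ)⁻¹ • n • v :=
      smul_le_smul_of_nonneg_left ht (inv_nonneg.2 hn'.le)
    rw [← Nat.cast_smul_eq_nsmul ℝ n v, inv_smul_smul₀ hn'.ne', smul_smul] at h1
    have h2 := key _ _ h1
    rwa [inv_mul_le_iff₀ hn'] at h2

/-- A maximal functional is homogeneous, being additive and monotone. -/
theorem mem_latticeCharacters_of_maximal (hu : ∀ v : E, ∃ t : ℝ, v ≤ t • e) (he : 0 < e)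
    (hq : Maximal (IsMinFunctional e) q) : q ∈ latticeCharacters e := by
  have hadd := add_of_maximal hu hq
  refine ⟨hadd, fun c v => ?_, hq.1.map_inf, by simpa using hq.1.map_smul_unit 1⟩
  obtain ⟨s₁, hs₁⟩ := hu v
  obtain ⟨s₂, hs₂⟩ := hu (-v)
  set s := max s₁ s₂
  have hs₁' : v ≤ s • e := hs₁.trans (smul_le_smul_of_nonneg_right (le_max_left _ _) he.le)
  have hs₂' : -v ≤ s • e := hs₂.trans (smul_le_smul_of_nonneg_right (le_max_right _ _) he.le)
  have hle : ∀ (c : ℝ) (w : E), w ≤ s • e → -w ≤ s • e → q (c • w) ≤ s * ‖c‖ := by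
    refine fun c w h1 h2 => hq.1.le_of_le_smul ?_
    rw [mul_comm, mul_smul, Real.norm_eq_abs]
    rcases le_total 0 c with hc | hc
    · rw [abs_of_nonneg hc]
      exact smul_le_smul_of_nonneg_left h1 hc
    · rw [abs_of_nonpos hc, ← neg_smul_neg c w]
      exact smul_le_smul_of_nonneg_left h2 (neg_nonneg.2 hc)
  -- Along the line through `v`, an additive map with a linear bound is continuous, hence
  -- real-linear.
  let g : ℝ →+ ℝ :=
    { toFun := fun c => q (c • v)
      map_zero' := by simp [hq.1.map_zero]
      map_add' := fun a b => by rw [add_smul, hadd] }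
  have hg : Continuous g := by
    refine AddMonoidHomClass.continuous_of_bound g s fun c => ?_
    rw [Real.norm_eq_abs, abs_le']
    refine ⟨hle c v hs₁' hs₂', ?_⟩
    rw [← map_neg]
    simpa [g] using hle c (-v) hs₂' (by simpa using hs₁')
  simpa [g] using map_real_smul g hg c 1

end IsMinFunctional

variable [IsOrderedAddMonoid E] [IsOrderedModule ℝ E]

/-- Lattice characters detect the lower bounds `t • e ≤ v` in a vector lattice with order unit. -/
theorem exists_latticeCharacter_le (he : 0 < e) (hu : ∀ v : E, ∃ t : ℝ, v ≤ t • e) {v : E} {t : ℝ}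
    (h : ¬ t • e ≤ v) : ∃ φ ∈ latticeCharacters e, φ v ≤ t := by
  have hp := IsMinFunctional.sSup_smul_le he hu
  set p : E → ℝ := fun v => sSup {t : ℝ | t • e ≤ v}
  have hpt : p v ≤ t := by
    obtain ⟨s, hs⟩ := hu (-v)
    refine csSup_le ⟨-s, by simpa [neg_smul] using neg_le_neg hs⟩ fun r hr => ?_
    by_contra! htr
    exact h ((smul_le_smul_of_nonneg_right htr.le he.le).trans hr)
  have hb := hp.map_add_neg_smul v
  obtain ⟨q, hq, -, hqb⟩ := hp.exists_ge_map_add_le hu hb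
  obtain ⟨φ, hqφ, hφ⟩ := hq.exists_maximal_ge hu
  have hmem := IsMinFunctional.mem_latticeCharacters_of_maximal hu he hφ
  refine ⟨φ, hmem, ?_⟩
  -- With `b = v - p v • e`, localisation tested at `-b` gives `0 ≤ φ (-b)`, so `φ v ≤ p v ≤ t`.
  have h1 := (hqb (-(v + (-p v) • e))).trans (hqφ _)
  rw [neg_add_cancel, hp.map_zero] at h1
  have h2 := hφ.1.superadd (v + (-p v) • e) (-(v + (-p v) • e))
  rw [add_neg_cancel, hφ.1.map_zero, IsMinFunctional.add_of_maximal hu hφ v,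
    hφ.1.map_smul_unit] at h2
  linarith

end OrderUnit

/-! ### Lattice homomorphisms and Stone–Weierstrass -/

theorem IsLatticeHom.of_map_inf {X Y : Type*}
    [NormedAddCommGroup X] [NormedSpace ℝ X] [Lattice X] [BanachLattice X]
    [NormedAddCommGroup Y] [NormedSpace ℝ Y] [Lattice Y] [BanachLattice Y]
    {T : X →L[ℝ] Y} (h : ∀ x y, T (x ⊓ y) = T x ⊓ T y) : IsLatticeHom T where
  map_sup x y := by
    have h1 := congrArg T (inf_add_sup x y)
    rw [map_add, map_add, h, ← inf_add_sup (T x)] at h1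
    exact add_left_cancel h1
  map_inf := h

theorem IsLatticeHom.mono {X Y : Type*}
    [NormedAddCommGroup X] [NormedSpace ℝ X] [Lattice X] [BanachLattice X]
    [NormedAddCommGroup Y] [NormedSpace ℝ Y] [Lattice Y] [BanachLattice Y]
    {T : X →L[ℝ] Y} (hT : IsLatticeHom T) : Monotone T := fun x y h => by
  rw [← sup_eq_right, ← hT.map_sup, sup_eq_right.2 h]

/-- Lattice form of the Stone–Weierstrass theorem for linear sublattices. -/
theorem Submodule.dense_of_inf_mem_of_separates {M : Type*} [TopologicalSpace M] [CompactSpace M]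
    (W : Submodule ℝ C(M, ℝ)) (hone : 1 ∈ W) (hinf : ∀ f ∈ W, ∀ g ∈ W, f ⊓ g ∈ W)
    (hsep : ∀ x y : M, x ≠ y → ∃ f ∈ W, f x ≠ f y) : Dense (W : Set C(M, ℝ)) := by
  rw [dense_iff_closure_eq]
  refine ContinuousMap.sublattice_closure_eq_top _ ⟨1, hone⟩ hinf (fun f hf g hg => ?_) ?_
  · have h := W.sub_mem (W.add_mem hf hg) (hinf f hf g hg)
    rwa [← inf_add_sup f g, add_sub_cancel_left] at h
  · intro v x y
    rcases eq_or_ne x y with rfl | hxy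
    · exact ⟨v x • 1, W.smul_mem _ hone, by simp, by simp⟩
    · obtain ⟨f, hf, hfxy⟩ := hsep x y hxy
      -- The affine function of `f` that interpolates `v` at both `x` and `y`.
      refine ⟨v x • 1 + ((v y - v x) / (f y - f x)) • (f - f x • 1),
        W.add_mem (W.smul_mem _ hone) (W.smul_mem _ (W.sub_mem hf (W.smul_mem _ hone))),
        by simp, ?_⟩
      have : f y - f x ≠ 0 := sub_ne_zero.2 hfxy.symm
      simp only [ContinuousMap.add_apply, ContinuousMap.smul_apply, ContinuousMap.sub_apply,
        ContinuousMap.one_apply, smul_eq_mul, mul_one]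
      field_simp
      ring

/-- Lattice homomorphisms on `C(M)` are determined by a separating family and the unit. -/
theorem IsLatticeHom.eq_of_separates {M Y : Type*} [TopologicalSpace M] [CompactSpace M]
    [NormedAddCommGroup Y] [NormedSpace ℝ Y] [Lattice Y] [BanachLattice Y]
    {S T : C(M, ℝ) →L[ℝ] Y} (hS : IsLatticeHom S) (hT : IsLatticeHom T) (hone : S 1 = T 1)
    (hsep : ∀ x y : M, x ≠ y → ∃ f : C(M, ℝ), S f = T f ∧ f x ≠ f y) : S = T := by
  have hdense := Submodule.dense_of_inf_mem_of_separates
    (LinearMap.eqLocus S.toLinearMap T.toLinearMap) hone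
    (fun f hf g hg => by
      simp only [LinearMap.mem_eqLocus, ContinuousLinearMap.coe_coe] at hf hg ⊢
      rw [hS.map_inf, hT.map_inf, hf, hg])
    (fun x y hxy => hsep x y hxy)
  ext1 f
  exact congrFun (Continuous.ext_on hdense S.continuous T.continuous fun f hf => hf) f

/-! ### The compact space of characters -/

section Characters

variable {E : Type*} [AddCommGroup E] [Module ℝ E] [Lattice E] {e : E}

theorem isClosed_latticeCharacters (e : E) : IsClosed (latticeCharacters e) := by
  simp only [latticeCharacters, Set.ofPred_and, Set.ofPred_forall]
  refine IsClosed.inter ?_ (IsClosed.inter ?_ (IsClosed.inter ?_ ?_))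
  · exact isClosed_iInter fun u => isClosed_iInter fun v => isClosed_eq (by fun_prop) (by fun_prop)
  · exact isClosed_iInter fun u => isClosed_iInter fun v => isClosed_eq (by fun_prop) (by fun_prop)
  · exact isClosed_iInter fun u => isClosed_iInter fun v => isClosed_eq (by fun_prop) (by fun_prop)
  · exact isClosed_eq (by fun_prop) (by fun_prop)

theorem latticeCharacters_mono {φ : E → ℝ} (hφ : φ ∈ latticeCharacters e) : Monotone φ :=
  fun u v h => by
    have := hφ.2.2.1 u v
    rw [inf_eq_left.2 h] at this
    rw [this]
    exact min_le_right _ _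

/-- Order bounds on `v` and `-v` confine each coordinate `φ v` to a compact interval, so Tychonoff
applies. -/
theorem isCompact_latticeCharacters (hu : ∀ v : E, ∃ t : ℝ, v ≤ t • e) :
    IsCompact (latticeCharacters e) := by
  choose b hb using hu
  refine (isCompact_univ_pi fun v => isCompact_Icc (a := -b (-v)) (b := b v)).of_isClosed_subset
    (isClosed_latticeCharacters e) fun φ hφ v _ => ?_
  have h1 : ∀ v, φ v ≤ b v := fun v => by
    have := latticeCharacters_mono hφ (hb v)
    rwa [hφ.2.1, hφ.2.2.2, mul_one] at this
  refine ⟨?_, h1 v⟩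
  have h2 := h1 (-v)
  have h3 := hφ.2.1 (-1) v
  rw [neg_one_smul] at h3
  linarith

/-- Evaluation of characters. -/
def latticeCharacters.eval (e : E) : E →ₗ[ℝ] C(latticeCharacters e, ℝ) where
  toFun v := ⟨fun φ => φ.1 v, (continuous_apply v).comp continuous_subtype_val⟩
  map_add' u v := ContinuousMap.ext fun φ => φ.2.1 u v
  map_smul' c v := ContinuousMap.ext fun φ => φ.2.2.1 c v

@[simp]
theorem latticeCharacters.eval_apply (v : E) (φ : latticeCharacters e) :
    latticeCharacters.eval e v φ = φ.1 v := rfl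

variable [IsOrderedAddMonoid E] [IsOrderedModule ℝ E]

/-- Lattice homomorphisms from an Archimedean vector lattice with order unit `e` to a Banach lattice
extend to the continuous functions on the characters. -/
theorem exists_latticeHom_extending_eval (he : 0 < e) (hu : ∀ v : E, ∃ t : ℝ, v ≤ t • e)
    (harch : ∀ v : E, (∀ t : ℝ, t < 0 → t • e ≤ v) → 0 ≤ v)
    {X : Type*} [NormedAddCommGroup X] [NormedSpace ℝ X] [Lattice X] [BanachLattice X]
    (j : E →ₗ[ℝ] X) (hj : ∀ u v, j (u ⊓ v) = j u ⊓ j v)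
    [CompactSpace (latticeCharacters e)] :
    ∃ Ψ : C(latticeCharacters e, ℝ) →L[ℝ] X, IsLatticeHom Ψ ∧
      ∀ v, Ψ (latticeCharacters.eval e v) = j v := by
  set ev := latticeCharacters.eval e
  have hinf : ∀ u v, ev (u ⊓ v) = ev u ⊓ ev v := fun u v =>
    ContinuousMap.ext fun φ => φ.2.2.2.1 u v
  have hone : ev e = 1 := ContinuousMap.ext fun φ => φ.2.2.2.2
  have hdense : DenseRange ev := by
    have := Submodule.dense_of_inf_mem_of_separates (LinearMap.range ev) ⟨e, hone⟩
      (by rintro _ ⟨u, rfl⟩ _ ⟨v, rfl⟩; exact ⟨u ⊓ v, hinf u v⟩)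
      (fun φ ψ hne => by
        by_contra! h
        exact hne (Subtype.ext (funext fun v => h _ ⟨v, rfl⟩)))
    rwa [LinearMap.coe_range] at this
  have hpos : ∀ v, (∀ φ ∈ latticeCharacters e, 0 ≤ φ v) → 0 ≤ v := fun v h => by
    refine harch v fun t ht => ?_
    by_contra hlt
    obtain ⟨φ, hφ, hle⟩ := exists_latticeCharacter_le he hu hlt
    exact absurd (h φ hφ) (by linarith)
  -- Order in `E` is detected by characters, so the sup norm of `ev v` bounds `v` itself; this makes
  -- `j` bounded with respect to `ev`.
  have hle : ∀ v, v ≤ ‖ev v‖ • e := fun v => by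
    refine sub_nonneg.1 (hpos _ fun φ hφ => ?_)
    have h1 := hφ.1 (‖ev v‖ • e - v) v
    rw [sub_add_cancel, hφ.2.1, hφ.2.2.2] at h1
    have h2 := (le_abs_self _).trans ((ev v).norm_coe_le_norm ⟨φ, hφ⟩)
    rw [latticeCharacters.eval_apply] at h2
    linarith
  have hjm : Monotone j := fun u v h => by
    rw [← inf_eq_left, ← hj, inf_eq_left.2 h]
  have hnorm : ∀ v, ‖j v‖ ≤ ‖j e‖ * ‖ev v‖ := fun v => by
    have h1 : |j v| ≤ |‖ev v‖ • j e| := by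
      refine (abs_le'.2 ⟨?_, ?_⟩).trans (le_abs_self _)
      · simpa using hjm (hle v)
      · simpa using hjm (hle (-v))
    simpa [norm_smul, mul_comm] using HasSolidNorm.solid h1
  have hext : ∀ v, j.extendOfNorm ev (ev v) = j v :=
    LinearMap.extendOfNorm_eq hdense ⟨_, hnorm⟩
  refine ⟨j.extendOfNorm ev, IsLatticeHom.of_map_inf fun f g => ?_, hext⟩
  refine hdense.induction_on₂ (p := fun f g => j.extendOfNorm ev (f ⊓ g) =
    j.extendOfNorm ev f ⊓ j.extendOfNorm ev g) ?_ (fun u v => ?_) f g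
  · exact isClosed_eq (by fun_prop) (by fun_prop)
  · rw [← hinf, hext, hext, hext, hj]

end Characters

/-! ### Functional calculus in a Banach lattice -/

section PrincipalIdeal

variable {X : Type*} [NormedAddCommGroup X] [NormedSpace ℝ X] [Lattice X] [BanachLattice X]

/-- The (order) ideal generated by an element of a Banach lattice. -/
def principalIdeal (x : X) : Submodule ℝ X where
  carrier := {y | ∃ t : ℝ, y ≤ t • x ∧ -y ≤ t • x}
  add_mem' := by
    rintro y z ⟨s, hs, hs'⟩ ⟨t, ht, ht'⟩
    refine ⟨s + t, ?_, ?_⟩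
    · rw [add_smul]; exact add_le_add hs ht
    · rw [add_smul, neg_add]; exact add_le_add hs' ht'
  zero_mem' := ⟨0, by simp⟩
  smul_mem' := by
    rintro c y ⟨t, ht, ht'⟩
    rcases le_total 0 c with hc | hc
    · refine ⟨c * t, ?_, ?_⟩ <;> rw [mul_smul]
      · exact smul_le_smul_of_nonneg_left ht hc
      · rw [← smul_neg]; exact smul_le_smul_of_nonneg_left ht' hc
    · refine ⟨-c * t, ?_, ?_⟩ <;> rw [mul_smul]
      · rw [← neg_smul_neg]; exact smul_le_smul_of_nonneg_left ht' (neg_nonneg.2 hc)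
      · rw [← neg_smul]; exact smul_le_smul_of_nonneg_left ht (neg_nonneg.2 hc)

theorem inf_mem_principalIdeal {x y z : X} (hx : 0 ≤ x) (hy : y ∈ principalIdeal x)
    (hz : z ∈ principalIdeal x) : y ⊓ z ∈ principalIdeal x := by
  obtain ⟨s, hs, hs'⟩ := hy
  obtain ⟨t, ht, ht'⟩ := hz
  refine ⟨max s t, ?_, ?_⟩
  · exact inf_le_left.trans (hs.trans (smul_le_smul_of_nonneg_right (le_max_left _ _) hx))
  · rw [neg_inf]
    exact sup_le (hs'.trans (smul_le_smul_of_nonneg_right (le_max_left _ _) hx))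
      (ht'.trans (smul_le_smul_of_nonneg_right (le_max_right _ _) hx))

theorem sup_mem_principalIdeal {x y z : X} (hx : 0 ≤ x) (hy : y ∈ principalIdeal x)
    (hz : z ∈ principalIdeal x) : y ⊔ z ∈ principalIdeal x := by
  have h := (principalIdeal x).sub_mem ((principalIdeal x).add_mem hy hz)
    (inf_mem_principalIdeal hx hy hz)
  rwa [← inf_add_sup y z, add_sub_cancel_left] at h

/-- Banach lattices are Archimedean. -/
theorem nonneg_of_forall_neg_smul_le {x v : X} (h : ∀ t : ℝ, t < 0 → t • x ≤ v) : 0 ≤ v := by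
  have h1 : Filter.Tendsto (fun t : ℝ => t • x) (nhdsWithin 0 (Set.Iio 0)) (nhds 0) := by
    have : Continuous fun t : ℝ => t • x := by fun_prop
    simpa using (this.tendsto 0).mono_left nhdsWithin_le_nhds
  exact le_of_tendsto h1 (eventually_nhdsWithin_of_forall h)

/-- Functional calculus: a family in the order interval `[0, x]` of a Banach lattice extends to a
lattice homomorphism on the continuous functions on the corresponding cube, sending `1` to `x`. -/
theorem exists_cube_calculus {Γ : Type*} {x : X} (hx : 0 ≤ x) (a : Γ → X)
    (ha : ∀ γ, 0 ≤ a γ ∧ a γ ≤ x) :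
    ∃ Φ : C(Γ → unitInterval, ℝ) →L[ℝ] X, IsLatticeHom Φ ∧ Φ 1 = x ∧
      ∀ γ, Φ ⟨fun y => (y γ : ℝ), by fun_prop⟩ = a γ := by
  rcases hx.eq_or_lt with rfl | hx0
  -- When `x = 0` the ideal has no nonzero unit, but then every `a γ` vanishes.
  · exact ⟨0, ⟨by simp, by simp⟩, rfl, fun γ => le_antisymm (ha γ).1 (ha γ).2⟩
  let _ : Lattice (principalIdeal x) :=
    Subtype.lattice (fun _ _ => sup_mem_principalIdeal hx) (fun _ _ => inf_mem_principalIdeal hx)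
  have : IsOrderedAddMonoid (principalIdeal x) := Submodule.toIsOrderedAddMonoid _
  have : IsOrderedModule ℝ (principalIdeal x) :=
    { smul_le_smul_of_nonneg_left := fun r hr a b h => smul_le_smul_of_nonneg_left (β := X) h hr
      smul_le_smul_of_nonneg_right := fun a ha r s h => smul_le_smul_of_nonneg_right (β := X) h ha }
  let e : principalIdeal x := ⟨x, 1, by simp, by simpa using (neg_nonpos.2 hx).trans hx⟩
  have he : 0 < e := hx0
  have hu : ∀ v : principalIdeal x, ∃ t : ℝ, v ≤ t • e := fun v => by
    obtain ⟨t, ht, -⟩ := v.2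
    exact ⟨t, ht⟩
  have : CompactSpace (latticeCharacters e) :=
    isCompact_iff_compactSpace.1 (isCompact_latticeCharacters hu)
  obtain ⟨Ψ, hΨ, hev⟩ := exists_latticeHom_extending_eval he hu
    (fun v h => nonneg_of_forall_neg_smul_le (X := X) (x := x) h)
    (principalIdeal x).subtype (fun _ _ => rfl)
  let b : Γ → principalIdeal x := fun γ =>
    ⟨a γ, 1, by simpa using (ha γ).2, by simpa using (neg_nonpos.2 (ha γ).1).trans hx⟩
  have hmem : ∀ (φ : latticeCharacters e) γ, φ.1 (b γ) ∈ unitInterval := fun φ γ => by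
    have h0 := φ.2.2.1 0 0
    rw [zero_smul, zero_mul] at h0
    refine ⟨?_, ?_⟩
    · rw [← h0]; exact latticeCharacters_mono φ.2 (ha γ).1
    · rw [← φ.2.2.2.2]; exact latticeCharacters_mono φ.2 (ha γ).2
  -- The joint spectrum of the family: composition with `c` pulls the coordinates back to the
  -- evaluations at `b γ`.
  let c : C(latticeCharacters e, Γ → unitInterval) :=
    ⟨fun φ γ => ⟨φ.1 (b γ), hmem φ γ⟩, continuous_pi fun γ =>
      ((continuous_apply (b γ)).comp continuous_subtype_val).subtype_mk _⟩
  let r : C(Γ → unitInterval, ℝ) →L[ℝ] C(latticeCharacters e, ℝ) :=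
    { toFun := fun f => f.comp c
      map_add' := fun _ _ => rfl
      map_smul' := fun _ _ => rfl
      cont := ContinuousMap.continuous_precomp c }
  refine ⟨Ψ.comp r, ?_, ?_, fun γ => ?_⟩
  · exact IsLatticeHom.of_map_inf fun f g => hΨ.map_inf (f.comp c) (g.comp c)
  · have : latticeCharacters.eval e e = 1 := ContinuousMap.ext fun φ => φ.2.2.2.2
    have h1 := hev e
    rw [this] at h1
    exact h1
  · exact hev (b γ)

end PrincipalIdeal

/-! ### From projectivity to neighbourhood retractions -/

section Retract

/-- A unital lattice homomorphism `C(K) → ℝ` is the evaluation at some point. -/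
theorem exists_eq_eval_of_latticeHom {K : Type*} [TopologicalSpace K] [CompactSpace K]
    (L : C(K, ℝ) →ₗ[ℝ] ℝ) (hsup : ∀ f g, L (f ⊔ g) = max (L f) (L g)) (hone : L 1 = 1) :
    ∃ k, ∀ f, L f = f k := by
  by_contra! hne
  choose f hf using hne
  have habs : ∀ g, L |g| = |L g| := fun g => by
    change L (g ⊔ -g) = _
    rw [hsup, map_neg]
    rfl
  have hmono : ∀ g h : C(K, ℝ), g ≤ h → L g ≤ L h := fun g h hgh => by
    rw [← sup_eq_right.2 hgh, hsup]
    exact le_max_left _ _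
  -- Each `g k` is nonnegative, killed by `L` and positive at `k`. By compactness a finite sum has a
  -- positive lower bound, contradicting `L 1 = 1`.
  let g : K → C(K, ℝ) := fun k => |f k - L (f k) • 1|
  have hg0 : ∀ k, L (g k) = 0 := fun k => by simp [g, habs, hone]
  have hgnn : ∀ k x, 0 ≤ g k x := fun k x => abs_nonneg _
  have hgk : ∀ k, 0 < g k k := fun k => by
    have : f k k - L (f k) ≠ 0 := sub_ne_zero.2 (hf k).symm
    simpa [g] using this
  obtain ⟨t, ht⟩ := isCompact_univ.elim_finite_subcover (fun k => {x | 0 < g k x})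
    (fun k => isOpen_lt continuous_const (g k).continuous)
    (fun x _ => Set.mem_iUnion.2 ⟨x, hgk x⟩)
  have hpos : ∀ x, 0 < (∑ k ∈ t, g k) x := fun x => by
    obtain ⟨k, hk⟩ := Set.mem_iUnion.1 (ht (Set.mem_univ x))
    obtain ⟨hkt, hk⟩ := Set.mem_iUnion.1 hk
    rw [ContinuousMap.sum_apply]
    exact Finset.sum_pos' (fun k _ => hgnn k x) ⟨k, hkt, hk⟩
  have hsum : L (∑ k ∈ t, g k) = 0 := by simp [hg0]
  have hK : Nonempty K := by
    by_contra h
    rw [not_nonempty_iff] at h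
    have : (1 : C(K, ℝ)) = 0 := ContinuousMap.ext fun k => h.elim k
    rw [this, map_zero] at hone
    exact zero_ne_one hone
  obtain ⟨x₀, -, hx₀⟩ := isCompact_univ.exists_isMinOn Set.univ_nonempty
    (∑ k ∈ t, g k).continuous.continuousOn
  have h1 : (∑ k ∈ t, g k) x₀ • (1 : C(K, ℝ)) ≤ ∑ k ∈ t, g k := fun x => by
    simpa using hx₀ (Set.mem_univ x)
  have h2 := hmono _ _ h1
  rw [map_smul, hone, hsum, smul_eq_mul, mul_one] at h2
  exact absurd (hpos x₀) (not_lt.2 h2)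

/-- A `lam`-projective Banach lattice splits norm-preserving lattice quotient maps onto it. -/
theorem IsLambdaProjective.exists_section {P Y : Type u}
    [NormedAddCommGroup P] [NormedSpace ℝ P] [Lattice P] [BanachLattice P]
    [NormedAddCommGroup Y] [NormedSpace ℝ Y] [Lattice Y] [BanachLattice Y] {lam : ℝ}
    (hP : IsLambdaProjective lam P) {R : Y →L[ℝ] P} (hR : IsLatticeHom R)
    (hlift : ∀ f, ∃ g, R g = f ∧ ‖g‖ ≤ ‖f‖) :
    ∃ S : P →L[ℝ] Y, IsLatticeHom S ∧ ∀ f, R (S f) = f := by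
  let J : Submodule ℝ Y := R.toLinearMap.ker
  have hJ : ∀ f, f ∈ J ↔ R f = 0 := fun f => LinearMap.mem_ker
  have hRabs : ∀ f, R |f| = |R f| := fun f => by
    change R (f ⊔ -f) = R f ⊔ -R f
    rw [hR.map_sup, map_neg]
  have : IsLatticeIdeal J := ⟨fun f hf g hgf => (hJ g).2 <| by
    have h1 := hR.mono hgf
    rw [hRabs, hRabs, (hJ f).1 hf, abs_zero] at h1
    exact le_antisymm ((le_abs_self _).trans h1) (neg_nonpos.1 ((neg_le_abs _).trans h1))⟩
  have : IsClosed (J : Set Y) := isClosed_singleton.preimage R.continuous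
  choose F hRF hF using hlift
  have hmk : ∀ g h : Y, R g = R h →
      (Submodule.Quotient.mk g : Y ⧸ J) = Submodule.Quotient.mk h := fun g h hgh =>
    (Submodule.Quotient.eq J).2 (LinearMap.sub_mem_ker_iff.2 hgh)
  let T₀ : P →ₗ[ℝ] Y ⧸ J :=
    { toFun := fun f => Submodule.Quotient.mk (F f)
      map_add' := fun f g => by
        rw [← Submodule.Quotient.mk_add]
        exact hmk _ _ (by rw [map_add, hRF, hRF, hRF])
      map_smul' := fun c f => by
        rw [RingHom.id_apply, ← Submodule.Quotient.mk_smul]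
        exact hmk _ _ (by rw [map_smul, hRF, hRF]) }
  let T : P →L[ℝ] Y ⧸ J := T₀.mkContinuous 1 fun f =>
    (Submodule.Quotient.norm_mk_le J _).trans ((hF f).trans (one_mul _).ge)
  have hT : IsLatticeHom T := IsLatticeHom.of_map_inf fun f g => by
    change (Submodule.Quotient.mk (F (f ⊓ g)) : Y ⧸ J) = Submodule.Quotient.mk (F f ⊓ F g)
    exact hmk _ _ (by rw [hRF, hR.map_inf, hRF, hRF])
  obtain ⟨S, hS, hST, -⟩ := hP Y J T hT
  refine ⟨S, hS, fun f => ?_⟩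
  have h1 : S f - F f ∈ J := (Submodule.Quotient.eq J).1 (hST f)
  rwa [hJ, map_sub, hRF, sub_eq_zero] at h1

/-- Projectivity lets one choose lattice-linear extensions of continuous functions along an
embedding of compact spaces. -/
theorem exists_latticeHom_extension_of_isLambdaProjective {K : Type u} [TopologicalSpace K]
    [CompactSpace K] {lam : ℝ} (hP : IsLambdaProjective lam C(K, ℝ)) {X : Type u}
    [TopologicalSpace X] [CompactSpace X] [T2Space X] {i : K → X}
    (hi : Topology.IsEmbedding i) :
    ∃ S : C(K, ℝ) →L[ℝ] C(X, ℝ), IsLatticeHom S ∧ ∀ f k, S f (i k) = f k := by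
  let R : C(X, ℝ) →L[ℝ] C(K, ℝ) :=
    { toFun := fun f => f.comp ⟨i, hi.continuous⟩
      map_add' := fun _ _ => rfl
      map_smul' := fun _ _ => rfl
      cont := ContinuousMap.continuous_precomp _ }
  obtain ⟨S, hS, hRS⟩ := hP.exists_section (R := R) (IsLatticeHom.of_map_inf fun _ _ => rfl)
    fun f => by
      obtain ⟨g, hg, hgf⟩ :=
        BoundedContinuousFunction.exists_extension_norm_eq_of_isClosedEmbedding
          (BoundedContinuousFunction.mkOfCompact f)
          (hi.continuous.isClosedEmbedding hi.injective)
      refine ⟨g.toContinuousMap, ContinuousMap.ext fun k => congrFun hgf k, ?_⟩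
      rw [BoundedContinuousFunction.norm_mkOfCompact] at hg
      rw [← hg]
      exact (ContinuousMap.norm_le _ (norm_nonneg _)).2 g.norm_coe_le_norm
  exact ⟨S, hS, fun f k => DFunLike.congr_fun (hRS f) k⟩

theorem isANR_of_isLambdaProjective {K : Type u} [TopologicalSpace K] [CompactSpace K] [T2Space K]
    {lam : ℝ} (hP : IsLambdaProjective lam C(K, ℝ)) : IsANR K := by
  intro X _ _ _ i hi
  obtain ⟨S, hS, hSi⟩ := exists_latticeHom_extension_of_isLambdaProjective hP hi
  let U : Set X := {x | 0 < S 1 x}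
  have hpt : ∀ x : U, ∃ k : K, ∀ f, S f x.1 / S 1 x.1 = f k := fun x => by
    have hx : 0 < S 1 x.1 := x.2
    refine exists_eq_eval_of_latticeHom
      { toFun := fun f => S f x.1 / S 1 x.1
        map_add' := fun f g => by rw [map_add, ContinuousMap.add_apply, add_div]
        map_smul' := fun c f => by
          rw [map_smul, ContinuousMap.smul_apply, smul_eq_mul, mul_div_assoc]; rfl }
      (fun f g => ?_) (div_self hx.ne')
    change S (f ⊔ g) x.1 / _ = max (S f x.1 / _) (S g x.1 / _)
    rw [hS.map_sup, ContinuousMap.sup_apply, max_div_div_right hx.le]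
  choose φ hφ using hpt
  have hmem : ∀ k, i k ∈ U := fun k => by
    change 0 < S 1 (i k)
    rw [hSi]
    exact one_pos
  have heq : ∀ k l : K, (∀ f : C(K, ℝ), f k = f l) → k = l := fun k l h => by
    by_contra hkl
    obtain ⟨f, hf, hfne⟩ := separatesPoints_continuous_of_t35Space hkl
    exact hfne (h ⟨f, hf⟩)
  refine ⟨U, φ, isOpen_lt continuous_const (S 1).continuous, ?_, hmem, fun k => ?_⟩
  -- `K` carries the topology induced by its continuous functions, so continuity of `φ` reduces to
  -- that of the quotients `S f / S 1`.
  · have hemb : Topology.IsInducing fun (k : K) (f : C(K, ℝ)) => f k := by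
      refine (Continuous.isClosedEmbedding (by fun_prop) fun k l h => ?_).isInducing
      exact heq k l (congrFun h)
    rw [hemb.continuous_iff]
    refine continuous_pi fun f => ?_
    have : (fun x : U => S f x.1 / S 1 x.1) = fun x => f (φ x) := funext fun x => hφ x f
    change Continuous fun x => f (φ x)
    rw [← this]
    exact Continuous.div (by fun_prop) (by fun_prop) fun x => x.2.ne'
  · refine heq _ _ fun f => ?_
    rw [← hφ ⟨i k, hmem k⟩ f]
    simp [hSi]

/-! ### From neighbourhood retractions to projectivity -/

/-- Multiplying `f ∘ φ` by a cut-off function `h` supported in the domain `U` of `φ`. -/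
theorem continuous_cutoff {M K : Type*} [TopologicalSpace M] [TopologicalSpace K] {U : Set M}
    (hU : IsOpen U) {φ : U → K} (hφ : Continuous φ) (h : C(M, ℝ)) (hh : tsupport h ⊆ U)
    (f : C(K, ℝ)) :
    Continuous (Function.extend Subtype.val (fun y : U => h y * f (φ y)) 0) := by
  have hout : ∀ y ∉ U, Function.extend Subtype.val (fun y : U => h y * f (φ y)) 0 y = 0 :=
    fun y hy => Function.extend_apply' _ _ _ fun ⟨z, hz⟩ => hy (hz ▸ z.2)
  refine continuous_of_tsupport fun y hy => ?_
  have hyU : y ∈ U := by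
    refine hh (closure_mono (fun z hz => ?_) hy)
    by_contra hz'
    refine hz ?_
    by_cases hzU : z ∈ U
    · have := Subtype.val_injective.extend_apply (fun y : U => h y * f (φ y)) 0 ⟨z, hzU⟩
      rw [this, Function.notMem_support.1 hz', zero_mul]
    · exact hout z hzU
  lift y to U using hyU
  rw [← hU.isOpenEmbedding_subtypeVal.continuousAt_iff, Function.extend_comp Subtype.val_injective]
  exact Continuous.continuousAt (by fun_prop)

/-- A neighbourhood retraction of `M` onto `K` gives a positive lattice-linear extension
operator `C(K) → C(M)`. -/
theorem exists_latticeHom_extension_of_retraction {M K : Type*} [TopologicalSpace M]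
    [CompactSpace M] [T2Space M] [TopologicalSpace K] [CompactSpace K] {i : K → M}
    (hi : Continuous i) {U : Set M} (hU : IsOpen U) {φ : U → K} (hφ : Continuous φ)
    (hmem : ∀ k, i k ∈ U) (hret : ∀ k, φ ⟨i k, hmem k⟩ = k) :
    ∃ E : C(K, ℝ) →L[ℝ] C(M, ℝ), IsLatticeHom E ∧ E 1 ≤ 1 ∧ ∀ f k, E f (i k) = f k := by
  obtain ⟨h, hone, -, hsupp, hIcc⟩ := exists_continuousMap_one_of_isCompact_subset_isOpen
    (isCompact_range hi) hU (Set.range_subset_iff.2 hmem)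
  let g : C(K, ℝ) → C(M, ℝ) := fun f => ⟨_, continuous_cutoff hU hφ h hsupp f⟩
  have hin : ∀ f (y : U), g f y = h y * f (φ y) := fun f y =>
    Subtype.val_injective.extend_apply (fun y : U => h y * f (φ y)) 0 y
  have hout : ∀ f, ∀ y ∉ U, g f y = 0 := fun f y hy =>
    Function.extend_apply' (f := Subtype.val) (fun y : U => h y * f (φ y)) (0 : M → ℝ) y
      fun ⟨z, hz⟩ => hy (hz ▸ z.2)
  have hext : ∀ {f₁ f₂ : C(M, ℝ)}, (∀ y : U, f₁ y = f₂ y) → (∀ y ∉ U, f₁ y = f₂ y) → f₁ = f₂ :=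
    fun h1 h2 => ContinuousMap.ext fun y =>
      (Classical.em (y ∈ U)).elim (fun hy => h1 ⟨y, hy⟩) (h2 y)
  let E₀ : C(K, ℝ) →ₗ[ℝ] C(M, ℝ) :=
    { toFun := g
      map_add' := fun f₁ f₂ => hext (fun y => by simp [hin, mul_add])
        (fun y hy => by simp [hout _ y hy])
      map_smul' := fun c f => hext (fun y => by simp [hin, mul_left_comm])
        (fun y hy => by simp [hout _ y hy]) }
  have hbound : ∀ f, ‖E₀ f‖ ≤ 1 * ‖f‖ := fun f => by
    rw [one_mul]
    refine (ContinuousMap.norm_le _ (norm_nonneg f)).2 fun y => ?_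
    change ‖g f y‖ ≤ _
    by_cases hy : y ∈ U
    · rw [hin f ⟨y, hy⟩, norm_mul, Real.norm_of_nonneg (hIcc y).1]
      exact (mul_le_of_le_one_left (norm_nonneg _) (hIcc y).2).trans (f.norm_coe_le_norm _)
    · rw [hout f y hy, norm_zero]
      exact norm_nonneg f
  refine ⟨E₀.mkContinuous 1 hbound, IsLatticeHom.of_map_inf fun f₁ f₂ => ?_, fun y => ?_,
    fun f k => ?_⟩
  · change g (f₁ ⊓ f₂) = g f₁ ⊓ g f₂
    refine hext (fun y => ?_) (fun y hy => ?_)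
    · simp [hin, mul_min_of_nonneg _ _ (hIcc y).1]
    · simp [hout _ y hy]
  · change g 1 y ≤ 1
    by_cases hy : y ∈ U
    · rw [hin 1 ⟨y, hy⟩]
      simpa using (hIcc y).2
    · rw [hout 1 y hy]
      exact zero_le_one
  · change g f (i k) = f k
    rw [hin f ⟨i k, hmem k⟩, hret, hone (Set.mem_range_self k)]
    simp

/-- Positive elements of a quotient Banach lattice lift to positive elements of almost the same
norm. -/
theorem exists_nonneg_lift {X : Type*} [NormedAddCommGroup X] [NormedSpace ℝ X] [Lattice X]
    [BanachLattice X] (J : Submodule ℝ X) [IsLatticeIdeal J] {z : X ⧸ J} (hz : 0 ≤ z)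
    {r : ℝ} (hr : ‖z‖ < r) : ∃ x : X, 0 ≤ x ∧ Submodule.Quotient.mk x = z ∧ ‖x‖ < r := by
  obtain ⟨x, rfl, hx⟩ := Submodule.Quotient.norm_mk_lt (S := J) z (sub_pos.2 hr)
  rw [add_sub_cancel] at hx
  refine ⟨x ⊔ 0, le_sup_right, ?_, lt_of_le_of_lt (HasSolidNorm.solid ?_) hx⟩
  · rw [IsLatticeIdeal.mk_sup]
    exact sup_eq_left.2 hz
  · rw [abs_of_nonneg (le_sup_right : 0 ≤ x ⊔ 0)]
    exact sup_le (le_abs_self x) (abs_nonneg x)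

/-- Elements of an order interval in a quotient Banach lattice lift to the order interval. -/
theorem exists_lift_mem_Icc {X : Type*} [NormedAddCommGroup X] [NormedSpace ℝ X] [Lattice X]
    [BanachLattice X] (J : Submodule ℝ X) [IsLatticeIdeal J] {x : X} (hx : 0 ≤ x) {z : X ⧸ J}
    (hz : 0 ≤ z) (hzx : z ≤ Submodule.Quotient.mk x) :
    ∃ a : X, (0 ≤ a ∧ a ≤ x) ∧ Submodule.Quotient.mk a = z := by
  obtain ⟨y, rfl⟩ := Submodule.Quotient.mk_surjective J z
  refine ⟨(y ⊔ 0) ⊓ x, ⟨le_inf le_sup_right hx, inf_le_right⟩, ?_⟩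
  rw [IsLatticeIdeal.mk_inf, IsLatticeIdeal.mk_sup]
  exact (congrArg (· ⊓ _) (sup_eq_left.2 hz)).trans (inf_eq_left.2 hzx)

theorem isOnePlusProjective_of_isANR {K : Type u} [TopologicalSpace K] [CompactSpace K] [T2Space K]
    (hK : IsANR K) : IsOnePlusProjective C(K, ℝ) := by
  intro ε hε X _ _ _ _ J _ _ T hT
  -- The case `T = 0` is separate because lifting `T 1` needs the strict inequality `‖T 1‖ < (1 + ε)
  -- * ‖T‖`: the quotient norm need not be attained.
  rcases (norm_nonneg T).eq_or_lt with hT0 | hTpos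
  · refine ⟨0, ⟨by simp, by simp⟩, fun p => ?_, by simp [← hT0]⟩
    have h1 := T.le_opNorm p
    rw [← hT0, zero_mul] at h1
    exact (norm_le_zero_iff.1 h1).symm
  have hT1 : ‖T 1‖ < (1 + ε) * ‖T‖ := by
    have h1 : ‖(1 : C(K, ℝ))‖ ≤ 1 := (ContinuousMap.norm_le _ zero_le_one).2 fun k => by simp
    have h2 : ‖T 1‖ ≤ ‖T‖ := (T.le_opNorm 1).trans (mul_le_of_le_one_right hTpos.le h1)
    nlinarith
  have hTnn : ∀ f : C(K, ℝ), 0 ≤ f → 0 ≤ T f := fun f hf => by simpa using hT.mono hf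
  obtain ⟨x, hx, hxT, hxnorm⟩ := exists_nonneg_lift J (hTnn 1 fun k => zero_le_one) hT1
  let ι : C(K, unitInterval) → C(K, ℝ) := fun γ => ⟨fun k => (γ k : ℝ), by fun_prop⟩
  have hlift : ∀ γ : C(K, unitInterval),
      ∃ a : X, (0 ≤ a ∧ a ≤ x) ∧ Submodule.Quotient.mk a = T (ι γ) := fun γ =>
    exists_lift_mem_Icc J hx (hTnn _ fun k => (γ k).2.1)
      (hxT ▸ hT.mono fun k => (γ k).2.2)
  choose a ha haT using hlift
  obtain ⟨Φ, hΦ, hΦ1, hΦa⟩ := exists_cube_calculus hx a ha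
  let i : C(K, C(K, unitInterval) → unitInterval) := ⟨fun k γ => γ k, by fun_prop⟩
  have hi : Topology.IsEmbedding i := by
    refine (i.continuous.isClosedEmbedding fun k l hkl => ?_).isEmbedding
    by_contra hne
    obtain ⟨f, hf, hfne⟩ := separatesPoints_continuous_of_t35Space_Icc hne
    exact hfne (congrFun hkl ⟨f, hf⟩)
  obtain ⟨U, φ, hU, hφ, hmem, hret⟩ := hK _ i hi
  obtain ⟨E, hE, hE1, hEi⟩ := exists_latticeHom_extension_of_retraction i.continuous hU hφ hmem hret
  let Q : X →L[ℝ] X ⧸ J := J.mkQL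
  let r : C(C(K, unitInterval) → unitInterval, ℝ) →L[ℝ] C(K, ℝ) :=
    { toFun := fun f => f.comp i
      map_add' := fun _ _ => rfl
      map_smul' := fun _ _ => rfl
      cont := ContinuousMap.continuous_precomp i }
  have hQΦ : Q.comp Φ = T.comp r := by
    refine IsLatticeHom.eq_of_separates (IsLatticeHom.of_map_inf fun f g => ?_)
      (IsLatticeHom.of_map_inf fun f g => ?_) ?_ fun y z hyz => ?_
    · exact congrArg (Submodule.Quotient.mk (p := J)) (hΦ.map_inf f g)
    · exact hT.map_inf (f.comp i) (g.comp i)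
    · change Submodule.Quotient.mk (Φ 1) = T 1
      rw [hΦ1, hxT]
    · obtain ⟨γ, hγ⟩ := Function.ne_iff.1 hyz
      refine ⟨⟨fun y => (y γ : ℝ), by fun_prop⟩, ?_, fun h => hγ (Subtype.ext h)⟩
      change Submodule.Quotient.mk (Φ _) = T (ι γ)
      rw [hΦa, haT]
  refine ⟨Φ.comp E, IsLatticeHom.of_map_inf fun f g => ?_, fun f => ?_, ?_⟩
  · change Φ (E (f ⊓ g)) = Φ (E f) ⊓ Φ (E g)
    rw [hE.map_inf, hΦ.map_inf]
  · have h1 := DFunLike.congr_fun hQΦ (E f)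
    have h2 : r (E f) = f := ContinuousMap.ext fun k => hEi f k
    rw [ContinuousLinearMap.comp_apply, ContinuousLinearMap.comp_apply, h2] at h1
    exact h1
  · refine ContinuousLinearMap.opNorm_le_bound _ (hTpos.trans_le (by nlinarith)).le fun f => ?_
    -- From `E 1 ≤ 1` and `Φ 1 = x` the lift satisfies `|Φ (E f)| ≤ ‖f‖ • x`, so its norm is at most
    -- `‖x‖`.
    have hmono : Monotone (Φ.comp E) := hΦ.mono.comp hE.mono
    have hle : ∀ f : C(K, ℝ), (Φ.comp E) f ≤ ‖f‖ • x := fun f => by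
      have h1 : f ≤ ‖f‖ • 1 := fun k => by
        simpa using (le_abs_self _).trans (f.norm_coe_le_norm k)
      refine (hmono h1).trans ?_
      rw [map_smul]
      refine smul_le_smul_of_nonneg_left ?_ (norm_nonneg f)
      rw [← hΦ1]
      exact hΦ.mono hE1
    have habs : |(Φ.comp E) f| ≤ |‖f‖ • x| := by
      refine (abs_le'.2 ⟨hle f, ?_⟩).trans (le_abs_self _)
      simpa using hle (-f)
    refine (HasSolidNorm.solid habs).trans ?_
    rw [norm_smul, norm_norm, mul_comm]
    exact mul_le_mul_of_nonneg_right hxnorm.le (norm_nonneg f)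

end Retract

theorem theorem1p3 (K : Type u) [TopologicalSpace K] [CompactSpace K] [T2Space K] :
    IsOnePlusProjective C(K, ℝ) ↔ IsANR K :=
  ⟨fun h => isANR_of_isLambdaProjective (h 1 one_pos), isOnePlusProjective_of_isANR⟩
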